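/- Let $0<q<1$ and $\mu>0$. Write $(a;q)_n=\prod_{k=0}^{n-1}(1-aq^k)$, $(a;q)_\infty=\prod_{k\ge 0}(1-aq^k)$, $(a_1,\dots,a_r;q)_\infty=\prod_j(a_j;q)_\infty$. Let $u_n=u_n^\mu(x;q)$ be the Al-Salam and Carlitz polynomials, defined by $u_0=1$, $u_1=\mu^{-1}(x-1+\mu)$ and $$\mu q^n u_{n+1}+(1-q^n)u_{n-1}=\bigl(x-(1-\mu)q^n\bigr)u_n\qquad(n\ge 1),$$ and put $$\tilde\rho(x)=\frac{(qx,-\mu^{-1}qx;q)_\infty}{(q,-\mu,-q/\mu;q)_\infty},\qquad d_n^2=q^{-n(n-1)/2}\frac{(q;q)_n}{\mu^n},\qquad \tilde\psi_n(x)=d_n^{-1}\bigl(\tilde\rho(x)|x|\bigr)^{1/2}u_n^\mu(x;q).$$ Let $L=\{q^s:s=0,1,2,\dots\}\cup\{-\mu q^s:s=0,1,2,\dots\}$, and for $t\in\mathbb C$ and $x,y\in L$ let $$K_t(x,y)=\sum_{n=0}^\infty t^n\tilde\psi_n(x)\tilde\psi_n(y).$$ Jackson's $q$-integral is $\int_0^a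 f(x)\,d_qx=a(1-q)\sum_{k\ge0}f(aq^k)q^k$ and $\int_a^b=\int_0^b-\int_0^a$; a function $f$ is called square integrable if $\int_{-\mu}^1|f(y)|^2|y|^{-1}d_qy$ converges. Then the following hold, where all series and $q$-integrals converge absolutely. 1. For all $t\in\mathbb C$ and $x,y\in L$ the series for $K_t(x,y)$ converges. Each $\tilde\psi_m$ is square integrable and not identically zero on $L$, and for all $t\in\mathbb C$, $m\ge0$, $x\in L$ $$t^m\tilde\psi_m(x)=(1-q)^{-1}\int_{-\mu}^1K_t(x,y)\,\tilde\psi_m(y)\,|y|^{-1}d_qy .$$ In particular, for $t=i$ the $\tilde\psi_m$ are eigenfunctions, with eigenvalues $i^m$, of the $q$-Fourier transform $$(Ff)(x)=(1-q)^{-1}\int_{-\mu}^1K_i(x,y)f(y)|y|^{-1}d_qy .$$ 2. For all $t,t'\in\mathbb C$ and $x,x'\in L$ $$(1-q)^{-1}\int_{-\mu}^1K_t(x,y)\,K_{t'}(x',y)\,|y|^{-1}d_qy=K_{tt'}(x,x').$$ 3. For all $x,x'\in L$, with $*$ denoting complex conjugation, $$(1-q)^{-1}\int_{-\mu}^1K_i(x,y)\,K_i^*(x',y)\,|y|^{-1}d_qy=\delta_{xx'}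 .$$ 4. (Inversion formula.) If $f$ is a square integrable complex-valued function, then $Ff$ is defined at every point of $L$ and square integrable, and for all $x\in L$ $$f(x)=(1-q)^{-1}\int_{-\mu}^1K_i^*(x,y)\,(Ff)(y)\,|y|^{-1}d_qy .$$ -/

import Mathlib

noncomputable section

namespace QOscillator

/-- The finite `q`-shifted factorial `(a;q)_n = ∏_{k<n} (1 - a q^k)`. -/
def qPoch (a q : ℝ) (n : ℕ) : ℝ := ∏ k ∈ Finset.range n, (1 - a * q ^ k)

/-- The infinite `q`-shifted factorial `(a;q)_∞ = ∏_{k≥0} (1 - a q^k)` (convergent for `|q| < 1`). -/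
def qPochInf (a q : ℝ) : ℝ := ∏' k : ℕ, (1 - a * q ^ k)

/-- The Al-Salam and Carlitz polynomials `u_n^μ(x;q)`, by their three-term recurrence relation
`μ q^n u_{n+1} + (1 - q^n) u_{n-1} = (x - (1 - μ) q^n) u_n`, `u_0 = 1`, `u_1 = μ⁻¹ (x - 1 + μ)`. -/
def alSalamCarlitz (q μ x : ℝ) : ℕ → ℝ
  | 0 => 1
  | 1 => μ⁻¹ * (x - 1 + μ)
  | n + 2 =>
      ((x - (1 - μ) * q ^ (n + 1)) * alSalamCarlitz q μ x (n + 1)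
        - (1 - q ^ (n + 1)) * alSalamCarlitz q μ x n) / (μ * q ^ (n + 1))

/-- The weight `ρ̃(x) = (qx, -qx/μ; q)_∞ / (q, -μ, -q/μ; q)_∞`. -/
def weight (q μ x : ℝ) : ℝ :=
  (qPochInf (q * x) q * qPochInf (-(μ⁻¹ * q * x)) q) /
    (qPochInf q q * qPochInf (-μ) q * qPochInf (-(q / μ)) q)

/-- The squared norm `d_n² = q^{-n(n-1)/2} (q;q)_n / μ^n`; note that `n.choose 2 = n(n-1)/2`. -/
def normSq (q μ : ℝ) (n : ℕ) : ℝ := (q ^ n.choose 2)⁻¹ * (qPoch q q n / μ ^ n)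

/-- The `q`-wave function `ψ̃_n(x) = d_n⁻¹ (ρ̃(x) |x|)^{1/2} u_n^μ(x;q)`. -/
def waveFun (q μ : ℝ) (n : ℕ) (x : ℝ) : ℝ :=
  (√(normSq q μ n))⁻¹ * √(weight q μ x * |x|) * alSalamCarlitz q μ x n

/-- The lattice `{q^s} ∪ {-μ q^s}`, `s = 0, 1, 2, …`, on which the oscillator lives. -/
def lattice (q μ : ℝ) : Set ℝ := {x | ∃ s : ℕ, x = q ^ s ∨ x = -μ * q ^ s}

/-- The terms of the kernel series. -/
def kernelTerm (q μ : ℝ) (t : ℂ) (x y : ℝ) (n : ℕ) : ℂ :=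
  t ^ n * (waveFun q μ n x : ℂ) * (waveFun q μ n y : ℂ)

/-- The kernel `K_t(x,y) = ∑_n t^n ψ̃_n(x) ψ̃_n(y)`. -/
def kernel (q μ : ℝ) (t : ℂ) (x y : ℝ) : ℂ := ∑' n : ℕ, kernelTerm q μ t x y n

/-- Jackson's `q`-integral from `0`: `∫_0^a f(x) d_q x = a (1 - q) ∑_k f(a q^k) q^k`. -/
def jacksonZero (q a : ℝ) (f : ℝ → ℂ) : ℂ :=
  (a : ℂ) * (1 - (q : ℂ)) * ∑' k : ℕ, f (a * q ^ k) * (q : ℂ) ^ k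

/-- Jackson's `q`-integral `∫_a^b f(x) d_q x = ∫_0^b f(x) d_q x - ∫_0^a f(x) d_q x`. -/
def jackson (q a b : ℝ) (f : ℝ → ℂ) : ℂ := jacksonZero q b f - jacksonZero q a f

/-- (Absolute) convergence of the two series in the `q`-integral of `f` from `a` to `b`. -/
def JacksonIntegrable (q a b : ℝ) (f : ℝ → ℂ) : Prop :=
  Summable (fun k : ℕ => f (b * q ^ k) * (q : ℂ) ^ k) ∧
    Summable (fun k : ℕ => f (a * q ^ k) * (q : ℂ) ^ k)

/-- Integrability of `f` over `[-μ, 1]` with respect to `|y|⁻¹ d_q y`. -/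
def OscIntegrable (q μ : ℝ) (f : ℝ → ℂ) : Prop :=
  JacksonIntegrable q (-μ) 1 (fun y => f y * ((|y|⁻¹ : ℝ) : ℂ))

/-- The normalized integral `(1 - q)⁻¹ ∫_{-μ}^1 f(y) |y|⁻¹ d_q y`. -/
def oscIntegral (q μ : ℝ) (f : ℝ → ℂ) : ℂ :=
  (1 - (q : ℂ))⁻¹ * jackson q (-μ) 1 (fun y => f y * ((|y|⁻¹ : ℝ) : ℂ))

/-- Square integrability with respect to `|y|⁻¹ d_q y` on `[-μ, 1]`. -/
def OscSquareIntegrable (q μ : ℝ) (f : ℝ → ℂ) : Prop :=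
  OscIntegrable q μ (fun y => ((‖f y‖ ^ 2 : ℝ) : ℂ))

/-- The integral operator with kernel `K_t`:
`f ↦ (1 - q)⁻¹ ∫_{-μ}^1 K_t(x,y) f(y) |y|⁻¹ d_q y`; for `t = i` the `q`-Fourier transform. -/
def qTransform (q μ : ℝ) (t : ℂ) (f : ℝ → ℂ) (x : ℝ) : ℂ :=
  oscIntegral q μ (fun y => kernel q μ t x y * f y)

end QOscillator

end

/-!
The factor `|y|⁻¹` turns Jackson's `q`-integral over `[-μ, 1]` into a sum over the lattice, so all
statements concern `ℓ²` of the lattice, and they follow once the wave functions are known to be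
a Hilbert basis of it (`exists_hilbertBasis_waveFun`): the operator with kernel `K_t` then multiplies
the `n`-th Fourier coefficient by `t ^ n`, and `K_1` is the identity.

*Orthogonality.* The lowering relation `alSalamCarlitz_sub_dilate` and the three-term recurrence
give the raising relation `alSalamCarlitz_raise`. Together with the `q`-Pearson equation
`weight_eq_mul` it makes the sums of `ρ̃(x) x u_{n+1}(x)` over each branch of the lattice telescope;
with the masses `ρ̃(x) |x|` the two branches cancel, so `u_{n+1}` is orthogonal to `u_0`. Since
multiplication by `x` is symmetric, the three-term recurrence yields all the other orthogonality
relations and the norms up to the total mass (`massForm_eq_zero_of_lt`, `massForm_self`).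

*Completeness.* The orthogonality measure lives on a compact interval, so polynomials are dense
by the Weierstrass theorem (`eq_zero_of_moments_eq_zero`).

*Total mass.* Since `u_n(1) = 1` for all `n`, Parseval's identity for the unit vector at the point
`1` expresses the total mass through `∑ d_n⁻²`, which is `(-μ;q)_∞` by Euler's identity
(`tsum_inv_normSq`). This replaces the theta-type identity behind the normalization.

*Convergence of the kernel.* At a lattice point `u_n` grows at most geometrically in `n`: this holds
at the two end points, where `u_n` is explicit, and the lowering relation carries it inwards
(`exists_alSalamCarlitz_le`). The norms `d_n` grow like `q^{-n²/4}`, so the series for `K_t`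
converges for every complex `t`.
-/

open Filter Topology
open scoped ComplexConjugate lp InnerProductSpace

namespace QOscillator

/-! ### Infinite `q`-shifted factorials -/

lemma qPochInf_summable_norm {q : ℝ} (hq0 : 0 < q) (hq1 : q < 1) (a : ℝ) :
    Summable fun k : ℕ => ‖-(a * q ^ k)‖ :=
  ((summable_geometric_of_lt_one hq0.le hq1).mul_left a).neg.norm

lemma qPochInf_multipliable {q : ℝ} (hq0 : 0 < q) (hq1 : q < 1) (a : ℝ) :
    Multipliable fun k : ℕ => 1 - a * q ^ k := by
  simpa only [sub_eq_add_neg] using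
    multipliable_one_add_of_summable (qPochInf_summable_norm hq0 hq1 a)

lemma tendsto_qPoch {q : ℝ} (hq0 : 0 < q) (hq1 : q < 1) (a : ℝ) :
    Tendsto (qPoch a q) atTop (𝓝 (qPochInf a q)) :=
  (qPochInf_multipliable hq0 hq1 a).hasProd.tendsto_prod_nat

lemma qPochInf_eq_mul {q : ℝ} (hq0 : 0 < q) (hq1 : q < 1) (a : ℝ) :
    qPochInf a q = (1 - a) * qPochInf (q * a) q := by
  have h : (fun k : ℕ => 1 - q * a * q ^ k) = fun k : ℕ => 1 - a * q ^ (k + 1) := by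
    funext k; ring
  have hm := qPochInf_multipliable hq0 hq1 (q * a)
  rw [h] at hm
  have h0 := tprod_eq_zero_mul' (f := fun k : ℕ => 1 - a * q ^ k) hm
  simp only [pow_zero, mul_one] at h0
  simp only [qPochInf, h]
  exact h0

lemma qPochInf_pos {q : ℝ} (hq0 : 0 < q) (hq1 : q < 1) {a : ℝ} (ha : a < 1) :
    0 < qPochInf a q := by
  have hpos : ∀ k : ℕ, 0 < 1 - a * q ^ k := fun k => by
    have h1 : q ^ k ≤ 1 := pow_le_one₀ hq0.le hq1.le
    have h0 : 0 < q ^ k := by positivity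
    nlinarith
  refine lt_of_le_of_ne ?_ ?_
  · exact ge_of_tendsto' (tendsto_qPoch hq0 hq1 a) fun n =>
      Finset.prod_nonneg fun k _ => (hpos k).le
  · refine Ne.symm ?_
    simp only [qPochInf, sub_eq_add_neg]
    refine tprod_one_add_ne_zero_of_summable (fun k => ?_) (qPochInf_summable_norm hq0 hq1 a)
    have := (hpos k).ne'
    rwa [sub_eq_add_neg] at this

lemma tendsto_qPochInf_mul_pow {q : ℝ} (hq0 : 0 < q) (hq1 : q < 1) (a : ℝ) :
    Tendsto (fun k : ℕ => qPochInf (a * q ^ k) q) atTop (𝓝 1) := by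
  have hq := tendsto_pow_atTop_nhds_zero_of_lt_one hq0.le hq1
  have h := tendsto_tprod_one_add_of_dominated_convergence (𝓕 := atTop)
    (f := fun k j : ℕ => -(a * q ^ k * q ^ j)) (g := fun _ => 0)
    (bound := fun j => ‖-(a * q ^ j)‖) (qPochInf_summable_norm hq0 hq1 a)
    (fun j => by
      have := ((hq.const_mul a).mul_const (q ^ j)).neg
      simpa using this)
    (Eventually.of_forall fun k j => by
      have h1 : q ^ k ≤ 1 := pow_le_one₀ hq0.le hq1.le
      rw [norm_neg, norm_neg, mul_right_comm, norm_mul]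
      refine mul_le_of_le_one_right (norm_nonneg _) ?_
      rwa [Real.norm_of_nonneg (by positivity)])
  simpa [qPochInf, sub_eq_add_neg] using h

/-! ### The squared norms and Euler's identity -/

lemma qPoch_self_pos {q : ℝ} (hq0 : 0 < q) (hq1 : q < 1) (n : ℕ) : 0 < qPoch q q n := by
  refine Finset.prod_pos fun k _ => ?_
  rw [← pow_succ']
  exact sub_pos.2 (pow_lt_one₀ hq0.le hq1 k.succ_ne_zero)

lemma normSq_pos {q μ : ℝ} (hq0 : 0 < q) (hq1 : q < 1) (hμ : 0 < μ) (n : ℕ) :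
    0 < normSq q μ n := by
  have := qPoch_self_pos hq0 hq1 n
  unfold normSq
  positivity

lemma normSq_zero (q μ : ℝ) : normSq q μ 0 = 1 := by simp [normSq, qPoch]

lemma normSq_succ {q μ : ℝ} (hq0 : 0 < q) (hμ : 0 < μ) (n : ℕ) :
    normSq q μ (n + 1) = normSq q μ n * ((1 - q ^ (n + 1)) / (μ * q ^ n)) := by
  have h : (n + 1).choose 2 = n.choose 2 + n := by
    rw [Nat.choose_succ_succ' n 1, Nat.choose_one_right, add_comm]
  simp only [normSq, qPoch, Finset.prod_range_succ, h]
  field_simp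
  ring

/-- The norms `d_n` grow faster than any geometric sequence, because
`d_n² / d_{n+1}² = μ q^n / (1 - q^{n+1}) → 0`. -/
lemma summable_pow_mul_inv_sqrt_normSq {q μ : ℝ} (hq0 : 0 < q) (hq1 : q < 1) (hμ : 0 < μ)
    {r : ℝ} (hr : 0 < r) : Summable fun n : ℕ => r ^ n * (√(normSq q μ n))⁻¹ := by
  have hq := tendsto_pow_atTop_nhds_zero_of_lt_one hq0.le hq1
  refine summable_of_ratio_test_tendsto_lt_one (l := 0) zero_lt_one
    (Eventually.of_forall fun n => ?_) ?_
  · have := Real.sqrt_pos.2 (normSq_pos hq0 hq1 hμ n)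
    positivity
  · have hlim : Tendsto (fun n : ℕ => r * √(μ * q ^ n / (1 - q ^ (n + 1)))) atTop (𝓝 0) := by
      have h1 : Tendsto (fun n : ℕ => μ * q ^ n / (1 - q ^ (n + 1))) atTop (𝓝 0) := by
        have := (hq.const_mul μ).div (((tendsto_add_atTop_iff_nat 1).2 hq).const_sub 1) (by simp)
        simpa [Pi.div_def] using this
      simpa using (h1.sqrt).const_mul r
    refine hlim.congr fun n => ?_
    have hn := normSq_pos hq0 hq1 hμ n
    have h1 : 0 < 1 - q ^ (n + 1) := sub_pos.2 (pow_lt_one₀ hq0.le hq1 n.succ_ne_zero)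
    have hs := Real.sqrt_pos.2 hn
    rw [normSq_succ hq0 hμ, Real.sqrt_mul hn.le, ← inv_div (1 - q ^ (n + 1)) (μ * q ^ n),
      Real.sqrt_inv]
    have hd := Real.sqrt_pos.2 (show 0 < (1 - q ^ (n + 1)) / (μ * q ^ n) by positivity)
    set a := √(normSq q μ n)
    set b := √((1 - q ^ (n + 1)) / (μ * q ^ n))
    rw [Real.norm_of_nonneg (by positivity), Real.norm_of_nonneg (by positivity)]
    field_simp
    ring

lemma summable_inv_normSq {q μ : ℝ} (hq0 : 0 < q) (hq1 : q < 1) (hμ : 0 < μ) :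
    Summable fun n : ℕ => (normSq q μ n)⁻¹ := by
  have h := summable_pow_mul_inv_sqrt_normSq hq0 hq1 hμ one_pos
  simp only [one_pow, one_mul] at h
  have h2 := (h.mul_of_nonneg h (fun n => by positivity) (fun n => by positivity)).comp_injective
    (i := fun n : ℕ => (n, n)) fun m n hmn => (Prod.mk.inj hmn).1
  refine h2.congr fun n => ?_
  have hn := normSq_pos hq0 hq1 hμ n
  simp only [Function.comp]
  rw [← mul_inv, Real.mul_self_sqrt hn.le]

/-- **Euler's identity** `∑ q^{n(n-1)/2} μ^n / (q;q)_n = (-μ;q)_∞`. Both sides satisfy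
`F(μ) = (1 + μ) F(q μ)` and tend to `1` as `μ → 0`. -/
lemma tsum_inv_normSq {q μ : ℝ} (hq0 : 0 < q) (hq1 : q < 1) (hμ : 0 < μ) :
    ∑' n : ℕ, (normSq q μ n)⁻¹ = qPochInf (-μ) q := by
  -- Over all `μ` the norms are one power series: its `n`-th term is homogeneous of degree `n`.
  have hscale : ∀ (ν c : ℝ) (n : ℕ), (normSq q (c * ν) n)⁻¹ = c ^ n * (normSq q ν n)⁻¹ := by
    intro ν c n
    simp only [normSq, mul_inv, inv_div, inv_inv, mul_pow]
    ring
  have hfun : ∀ ν : ℝ, 0 < ν →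
      ∑' n : ℕ, (normSq q ν n)⁻¹ = (1 + ν) * ∑' n : ℕ, (normSq q (q * ν) n)⁻¹ := by
    intro ν hν
    have hs := summable_inv_normSq hq0 hq1 hν
    have hs' := summable_inv_normSq hq0 hq1 (mul_pos hq0 hν)
    have hstep : ∀ n : ℕ, (normSq q ν (n + 1))⁻¹ =
        (normSq q (q * ν) (n + 1))⁻¹ + ν * (normSq q (q * ν) n)⁻¹ := by
      intro n
      have h1 : 0 < 1 - q ^ (n + 1) := sub_pos.2 (pow_lt_one₀ hq0.le hq1 n.succ_ne_zero)
      have hn := normSq_pos hq0 hq1 hν n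
      rw [hscale, hscale, normSq_succ hq0 hν]
      field_simp
      ring
    rw [hs.tsum_eq_zero_add, hs'.tsum_eq_zero_add]
    simp only [hstep, normSq_zero]
    rw [((summable_nat_add_iff 1).2 hs').tsum_add (hs'.mul_left ν), tsum_mul_left,
      add_mul, one_mul]
    rw [hs'.tsum_eq_zero_add, normSq_zero]
    ring
  have hiter : ∀ N : ℕ, ∑' n : ℕ, (normSq q μ n)⁻¹ =
      qPoch (-μ) q N * ∑' n : ℕ, (normSq q (q ^ N * μ) n)⁻¹ := by
    intro N
    induction N with
    | zero => simp [qPoch]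
    | succ N ih =>
      rw [ih, hfun _ (by positivity), qPoch, qPoch, Finset.prod_range_succ, ← mul_assoc q,
        ← pow_succ']
      ring
  have hlim : Tendsto (fun N : ℕ => ∑' n : ℕ, (normSq q (q ^ N * μ) n)⁻¹) atTop (𝓝 1) := by
    have hz : (1 : ℝ) = ∑' n : ℕ, if n = 0 then (1 : ℝ) else 0 := by simp
    rw [hz]
    refine tendsto_tsum_of_dominated_convergence (summable_inv_normSq hq0 hq1 hμ) (fun n => ?_)
      (Eventually.of_forall fun N n => ?_)
    · rcases n with _ | n
      · simp [normSq_zero]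
      · have h := ((tendsto_pow_atTop_nhds_zero_of_lt_one hq0.le hq1).pow (n + 1)).mul_const
          (normSq q μ (n + 1))⁻¹
        simpa [hscale] using h
    · have hn := normSq_pos hq0 hq1 hμ n
      rw [hscale, Real.norm_of_nonneg (by positivity)]
      exact mul_le_of_le_one_left (by positivity)
        (pow_le_one₀ (by positivity) (pow_le_one₀ hq0.le hq1.le))
  have h := (tendsto_qPoch hq0 hq1 (-μ)).mul hlim
  rw [mul_one] at h
  exact tendsto_nhds_unique (tendsto_const_nhds.congr hiter) h

/-! ### Algebra of the Al-Salam and Carlitz polynomials -/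

/-- The three-term recurrence, solved for `x u_n`. It includes `n = 0`, where the term with the
truncated index `n - 1` has the coefficient `1 - q^0 = 0`. -/
lemma mul_alSalamCarlitz {q μ : ℝ} (hq0 : 0 < q) (hμ : 0 < μ) (x : ℝ) (n : ℕ) :
    x * alSalamCarlitz q μ x n = μ * q ^ n * alSalamCarlitz q μ x (n + 1)
      + (1 - q ^ n) * alSalamCarlitz q μ x (n - 1)
      + (1 - μ) * q ^ n * alSalamCarlitz q μ x n := by
  rcases n with _ | n
  · simp only [alSalamCarlitz]
    field_simp
    ring
  · rw [alSalamCarlitz.eq_3, Nat.add_sub_cancel]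
    field_simp
    ring

/-- The lowering relation
`u_{n+1}(x) - u_{n+1}(q x) = (1 - q^{n+1}) μ⁻¹ q^{-n} x u_n(x)`. -/
lemma alSalamCarlitz_sub_dilate {q μ : ℝ} (hq0 : 0 < q) (hμ : 0 < μ) (x : ℝ) (n : ℕ) :
    μ * q ^ n * (alSalamCarlitz q μ x (n + 1) - alSalamCarlitz q μ (q * x) (n + 1)) =
      (1 - q ^ (n + 1)) * x * alSalamCarlitz q μ x n := by
  induction n using Nat.strong_induction_on with
  | _ n ih =>
    have h1 := mul_alSalamCarlitz hq0 hμ x n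
    have h2 := mul_alSalamCarlitz hq0 hμ (q * x) n
    rcases n with _ | _ | n
    · simp only [alSalamCarlitz]
      field_simp
      ring
    · simp only [alSalamCarlitz]
      field_simp
      ring
    · have i0 := ih n (by omega)
      have i1 := ih (n + 1) (by omega)
      have h3 := mul_alSalamCarlitz hq0 hμ x (n + 1)
      simp only [Nat.add_sub_cancel] at h1 h2 h3
      refine mul_left_cancel₀ (show μ * q ^ n ≠ 0 by positivity) ?_
      linear_combination -(μ * q ^ n) * h1 + μ * q ^ n * h2 - (1 - q ^ (n + 2)) * i0
        + (x - (1 - μ) * q ^ (n + 1)) * i1 + (1 - q ^ (n + 2)) * x * h3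

/-- The raising relation `(1 - q x)(1 + q x / μ) u_n(x) = u_n(q x) - q x u_{n+1}(q x)`. -/
lemma alSalamCarlitz_raise {q μ : ℝ} (hq0 : 0 < q) (hμ : 0 < μ) (x : ℝ) (n : ℕ) :
    (1 - q * x) * (1 + μ⁻¹ * q * x) * alSalamCarlitz q μ x n =
      alSalamCarlitz q μ (q * x) n - q * x * alSalamCarlitz q μ (q * x) (n + 1) := by
  have h1 := mul_alSalamCarlitz hq0 hμ x n
  have h2 := alSalamCarlitz_sub_dilate hq0 hμ x n
  rcases n with _ | n
  · simp only [alSalamCarlitz]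
    field_simp
    ring
  · have h3 := alSalamCarlitz_sub_dilate hq0 hμ x n
    simp only [Nat.add_sub_cancel] at h1
    have hinv : μ * μ⁻¹ = 1 := mul_inv_cancel₀ hμ.ne'
    refine mul_left_cancel₀ (show μ * q ^ n ≠ 0 by positivity) ?_
    linear_combination h3 - x * h2 - x * h1
      + q ^ n * (1 - q * x) * q * x * alSalamCarlitz q μ x (n + 1) * hinv

lemma alSalamCarlitz_one_right {q μ : ℝ} (hq0 : 0 < q) (hμ : 0 < μ) (n : ℕ) :
    alSalamCarlitz q μ 1 n = 1 := by
  induction n using Nat.strong_induction_on with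
  | _ n ih =>
    rcases n with _ | n
    · rfl
    · have h := mul_alSalamCarlitz hq0 hμ 1 n
      rw [ih n (by omega), ih (n - 1) (by omega)] at h
      have : 0 < μ * q ^ n := by positivity
      refine mul_left_cancel₀ this.ne' ?_
      linarith

lemma alSalamCarlitz_neg_right {q μ : ℝ} (hq0 : 0 < q) (hμ : 0 < μ) (n : ℕ) :
    alSalamCarlitz q μ (-μ) n = (-μ⁻¹) ^ n := by
  induction n using Nat.strong_induction_on with
  | _ n ih =>
    rcases n with _ | n
    · rfl
    · have h := mul_alSalamCarlitz hq0 hμ (-μ) n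
      rw [ih n (by omega), ih (n - 1) (by omega)] at h
      have : 0 < μ * q ^ n := by positivity
      refine mul_left_cancel₀ this.ne' ?_
      have hinv : μ * μ⁻¹ = 1 := mul_inv_cancel₀ hμ.ne'
      generalize μ⁻¹ = i at h hinv ⊢
      rcases n with _ | n
      · linear_combination -h + hinv
      · rw [Nat.add_sub_cancel] at h
        linear_combination -h +
          ((-i) ^ n * (1 - q ^ (n + 1)) - q ^ (n + 1) * (-i) ^ n * i) * hinv

lemma continuous_alSalamCarlitz (q μ : ℝ) (n : ℕ) :
    Continuous fun x => alSalamCarlitz q μ x n := by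
  induction n using Nat.strong_induction_on with
  | _ n ih =>
    rcases n with _ | _ | n
    · simp only [alSalamCarlitz]; fun_prop
    · simp only [alSalamCarlitz]; fun_prop
    · have h0 := ih n (by omega)
      have h1 := ih (n + 1) (by omega)
      simp only [alSalamCarlitz]
      fun_prop

/-- At a lattice point `u_n` grows at most geometrically in `n`. The end points `1` and `-μ` have
`u_n = 1` and `u_n = (-μ⁻¹)^n`, and a step `x ↦ q x` costs a factor `q^{-n}`. -/
lemma exists_alSalamCarlitz_le {q μ : ℝ} (hq0 : 0 < q) (hq1 : q < 1) (hμ : 0 < μ) {c : ℝ}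
    (hc : c = 1 ∨ c = -μ) (s : ℕ) :
    ∃ C R : ℝ, 0 < C ∧ 0 < R ∧ ∀ n, |alSalamCarlitz q μ (c * q ^ s) n| ≤ C * R ^ n := by
  induction s with
  | zero =>
    rcases hc with rfl | rfl
    · exact ⟨1, 1, one_pos, one_pos, fun n => by simp [alSalamCarlitz_one_right hq0 hμ]⟩
    · refine ⟨1, μ⁻¹, one_pos, by positivity, fun n => ?_⟩
      simp [alSalamCarlitz_neg_right hq0 hμ, abs_of_pos hμ]
  | succ s ih =>
    obtain ⟨C, R, hC, hR, h⟩ := ih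
    have hq' : 1 < q⁻¹ := (one_lt_inv₀ hq0).2 hq1
    set x := c * q ^ s with hx
    have hx' : c * q ^ (s + 1) = q * x := by rw [hx]; ring
    refine ⟨C * (1 + |x| * μ⁻¹ * R⁻¹), R * q⁻¹, by positivity, by positivity, fun n => ?_⟩
    rw [hx', mul_pow]
    rcases n with _ | n
    · have h0 := h 0
      simp only [pow_zero, mul_one] at h0 ⊢
      refine h0.trans (le_mul_of_one_le_right hC.le ?_)
      have : 0 ≤ |x| * μ⁻¹ * R⁻¹ := by positivity
      linarith
    · have hl := alSalamCarlitz_sub_dilate hq0 hμ x n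
      have hq1' : 0 ≤ 1 - q ^ (n + 1) := sub_nonneg.2 (pow_le_one₀ hq0.le hq1.le)
      have hq2 : 1 - q ^ (n + 1) ≤ 1 := sub_le_self _ (by positivity)
      have heq : alSalamCarlitz q μ (q * x) (n + 1) = alSalamCarlitz q μ x (n + 1)
          - (1 - q ^ (n + 1)) * (x * μ⁻¹ * q⁻¹ ^ n * alSalamCarlitz q μ x n) := by
        rw [inv_pow]
        field_simp
        linarith
      have hp : 1 ≤ q⁻¹ ^ (n + 1) := one_le_pow₀ hq'.le
      have hp' : q⁻¹ ^ n ≤ q⁻¹ ^ (n + 1) := pow_le_pow_right₀ hq'.le n.le_succ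
      calc |alSalamCarlitz q μ (q * x) (n + 1)|
          ≤ |alSalamCarlitz q μ x (n + 1)|
            + |x| * μ⁻¹ * q⁻¹ ^ n * |alSalamCarlitz q μ x n| := by
            rw [heq]
            refine (abs_sub _ _).trans (add_le_add le_rfl ?_)
            rw [abs_mul, abs_of_nonneg hq1', abs_mul, abs_mul, abs_mul,
              abs_of_pos (show 0 < μ⁻¹ by positivity), abs_of_pos (show 0 < q⁻¹ ^ n by positivity)]
            exact mul_le_of_le_one_left (by positivity) hq2
        _ ≤ C * R ^ (n + 1) * q⁻¹ ^ (n + 1) + |x| * μ⁻¹ * q⁻¹ ^ (n + 1) * (C * R ^ n) := by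
            refine add_le_add ((h (n + 1)).trans (le_mul_of_one_le_right (by positivity) hp)) ?_
            gcongr
            exact h n
        _ = C * (1 + |x| * μ⁻¹ * R⁻¹) * (R ^ (n + 1) * q⁻¹ ^ (n + 1)) := by
            rw [pow_succ R]
            field_simp

/-! ### Determinacy of compactly supported discrete measures -/

/-- A finite complex measure supported on countably many points of a compact interval is determined
by its moments: by the Weierstrass theorem it annihilates all continuous functions, in particular
spikes that shrink to a single atom. -/
lemma eq_zero_of_moments_eq_zero {ι : Type*} {g : ι → ℂ} (hg : Summable fun i => ‖g i‖)
    {x : ι → ℝ} (hx : Function.Injective x) {a b : ℝ} (hab : ∀ i, x i ∈ Set.Icc a b)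
    (hmom : ∀ k : ℕ, ∑' i, g i * (x i : ℂ) ^ k = 0) (i : ι) : g i = 0 := by
  classical
  have hbound : ∀ φ : ℝ → ℝ, ContinuousOn φ (Set.Icc a b) →
      Summable fun i => g i * (φ (x i) : ℂ) := by
    intro φ hφ
    obtain ⟨B, hB⟩ := isCompact_Icc.exists_bound_of_continuousOn hφ
    refine (hg.mul_right B).of_norm_bounded fun i => ?_
    rw [norm_mul, Complex.norm_real]
    exact mul_le_mul_of_nonneg_left (hB _ (hab i)) (norm_nonneg _)
  have hpoly : ∀ p : Polynomial ℝ, ∑' i, g i * ((p.eval (x i) : ℝ) : ℂ) = 0 := by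
    intro p
    have h : ∀ i, g i * ((p.eval (x i) : ℝ) : ℂ) =
        ∑ k ∈ Finset.range (p.natDegree + 1), (p.coeff k : ℂ) * (g i * (x i : ℂ) ^ k) := by
      intro i
      rw [Polynomial.eval_eq_sum_range]
      push_cast
      rw [Finset.mul_sum]
      exact Finset.sum_congr rfl fun k _ => by ring
    simp only [h]
    rw [Summable.tsum_finsetSum]
    · refine Finset.sum_eq_zero fun k _ => ?_
      rw [tsum_mul_left, hmom, mul_zero]
    · intro k _
      refine Summable.mul_left _ ?_
      simpa using hbound (fun y => y ^ k) (by fun_prop)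
  have hcont : ∀ φ : ℝ → ℝ, Continuous φ → ∑' i, g i * (φ (x i) : ℂ) = 0 := by
    intro φ hφ
    have hle : ∀ ε : ℝ, 0 < ε → ‖∑' i, g i * (φ (x i) : ℂ)‖ ≤ ε * ∑' i, ‖g i‖ := by
      intro ε hε
      obtain ⟨p, hp⟩ := exists_polynomial_near_of_continuousOn a b φ hφ.continuousOn ε hε
      have hsub : ∑' i, g i * (φ (x i) : ℂ) =
          ∑' i, g i * ((φ (x i) - p.eval (x i) : ℝ) : ℂ) := by
        rw [← sub_zero (∑' i, g i * (φ (x i) : ℂ)), ← hpoly p,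
          ← (hbound φ hφ.continuousOn).tsum_sub (hbound _ p.continuous.continuousOn)]
        exact tsum_congr fun i => by push_cast; ring
      rw [hsub, ← tsum_mul_left]
      refine tsum_of_norm_bounded (hg.mul_left ε).hasSum fun i => ?_
      rw [norm_mul, Complex.norm_real, mul_comm, Real.norm_eq_abs, abs_sub_comm]
      exact mul_le_mul_of_nonneg_right (hp _ (hab i)).le (norm_nonneg _)
    have hlim : Tendsto (fun ε : ℝ => ε * ∑' i, ‖g i‖) (𝓝[>] 0) (𝓝 0) := by
      have : Tendsto (fun ε : ℝ => ε * ∑' i, ‖g i‖) (𝓝 0) (𝓝 (0 * ∑' i, ‖g i‖)) :=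
        tendsto_id.mul_const _
      rw [zero_mul] at this
      exact this.mono_left nhdsWithin_le_nhds
    have h0 := ge_of_tendsto hlim (eventually_mem_nhdsWithin.mono fun ε hε => hle ε hε)
    exact norm_le_zero_iff.1 h0
  let φ : ℕ → ℝ → ℝ := fun N y => max 0 (1 - N * |y - x i|)
  have hφ1 : ∀ N y, φ N y ≤ 1 := fun N y => max_le zero_le_one (sub_le_self _ (by positivity))
  have hφ0 : ∀ N y, 0 ≤ φ N y := fun N y => le_max_left _ _
  have hlim : Tendsto (fun N => ∑' j, g j * (φ N (x j) : ℂ)) atTop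
      (𝓝 (∑' j, if j = i then g j else 0)) := by
    refine tendsto_tsum_of_dominated_convergence hg (fun j => ?_)
      (Eventually.of_forall fun N j => ?_)
    · by_cases hj : j = i
      · simp [φ, hj]
      · rw [if_neg hj]
        have hd : 0 < |x j - x i| := abs_pos.2 (sub_ne_zero.2 fun h => hj (hx h))
        obtain ⟨N₀, hN₀⟩ := exists_nat_gt |x j - x i|⁻¹
        refine tendsto_const_nhds.congr' ((eventually_ge_atTop N₀).mono fun N hN => ?_)
        have hN' : |x j - x i|⁻¹ ≤ N := hN₀.le.trans (Nat.cast_le.2 hN)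
        have h1 : 1 ≤ N * |x j - x i| := by
          rwa [inv_le_iff_one_le_mul₀ hd] at hN'
        simp [φ, max_eq_left (sub_nonpos.2 h1)]
    · rw [norm_mul, Complex.norm_real, Real.norm_of_nonneg (hφ0 _ _)]
      exact mul_le_of_le_one_right (norm_nonneg _) (hφ1 _ _)
  rw [tsum_ite_eq] at hlim
  refine tendsto_nhds_unique hlim (tendsto_const_nhds.congr fun N => ?_)
  exact (hcont (φ N) (by fun_prop)).symm

/-! ### The lattice and its `q`-integral -/

/-- The points of the lattice: the first branch is `q^s`, the second is `-μ q^s`. -/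
noncomputable def latticePoint (q μ : ℝ) : ℕ ⊕ ℕ → ℝ
  | .inl s => q ^ s
  | .inr s => -μ * q ^ s

lemma mem_lattice_iff {q μ x : ℝ} : x ∈ lattice q μ ↔ ∃ i, latticePoint q μ i = x := by
  constructor
  · rintro ⟨s, rfl | rfl⟩
    exacts [⟨.inl s, rfl⟩, ⟨.inr s, rfl⟩]
  · rintro ⟨s | s, rfl⟩
    exacts [⟨s, .inl rfl⟩, ⟨s, .inr rfl⟩]

lemma latticePoint_injective {q μ : ℝ} (hq0 : 0 < q) (hq1 : q < 1) (hμ : 0 < μ) :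
    Function.Injective (latticePoint q μ) := by
  have hinj : Function.Injective fun s : ℕ => q ^ s := pow_right_injective₀ hq0 hq1.ne
  rintro (s | s) (t | t) h <;> simp only [latticePoint] at h
  · exact congrArg _ (hinj h)
  · have h1 : 0 < q ^ s := by positivity
    have h2 : 0 < μ * q ^ t := by positivity
    linarith
  · have h1 : 0 < q ^ t := by positivity
    have h2 : 0 < μ * q ^ s := by positivity
    linarith
  · exact congrArg _ (hinj (mul_left_cancel₀ (neg_ne_zero.2 hμ.ne') h))

lemma latticePoint_mem_Icc {q μ : ℝ} (hq0 : 0 < q) (hq1 : q < 1) (hμ : 0 < μ) (i : ℕ ⊕ ℕ) :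
    latticePoint q μ i ∈ Set.Icc (-μ) 1 := by
  have h0 : ∀ s : ℕ, 0 < q ^ s := fun s => by positivity
  have h1 : ∀ s : ℕ, q ^ s ≤ 1 := fun s => pow_le_one₀ hq0.le hq1.le
  rcases i with s | s
  · exact ⟨by linarith [h0 s, show latticePoint q μ (.inl s) = q ^ s from rfl], h1 s⟩
  · have := h0 s
    have := h1 s
    constructor <;> simp only [latticePoint] <;> nlinarith

lemma latticePoint_ne_zero {q μ : ℝ} (hq0 : 0 < q) (hμ : 0 < μ) (i : ℕ ⊕ ℕ) :
    latticePoint q μ i ≠ 0 := by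
  rcases i with s | s <;> simp [latticePoint, hq0.ne', hμ.ne']

lemma summable_sum_iff {f : ℕ ⊕ ℕ → ℂ} :
    Summable f ↔ Summable (fun s => f (.inl s)) ∧ Summable (fun s => f (.inr s)) :=
  ⟨fun h => ⟨h.comp_injective Sum.inl_injective, h.comp_injective Sum.inr_injective⟩,
    fun h => Summable.sum f h.1 h.2⟩

/-- The measure `|y|⁻¹ d_q y / (1 - q)` on `[-μ, 1]` is the counting measure of the lattice. -/
lemma oscIntegrable_iff {q μ : ℝ} (hq0 : 0 < q) (hμ : 0 < μ) {f : ℝ → ℂ} :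
    OscIntegrable q μ f ↔ Summable fun i => f (latticePoint q μ i) := by
  have hμ' : ((μ⁻¹ : ℝ) : ℂ) ≠ 0 := Complex.ofReal_ne_zero.2 (inv_ne_zero hμ.ne')
  have hq (s : ℕ) : (q : ℂ) ^ s ≠ 0 := pow_ne_zero _ (Complex.ofReal_ne_zero.2 hq0.ne')
  rw [summable_sum_iff, OscIntegrable, JacksonIntegrable]
  refine and_congr (Iff.of_eq (congrArg Summable (funext fun s => ?_))) ?_
  · have hs := hq s
    rw [one_mul, abs_of_pos (by positivity), latticePoint]
    push_cast
    field_simp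
  · refine Iff.trans ?_ (summable_mul_right_iff hμ')
    refine Iff.of_eq (congrArg Summable (funext fun s => ?_))
    have hs := hq s
    rw [abs_mul, abs_neg, abs_of_pos hμ, abs_of_pos (show 0 < q ^ s by positivity), latticePoint]
    push_cast
    field_simp

lemma oscIntegral_eq_tsum {q μ : ℝ} (hq0 : 0 < q) (hq1 : q < 1) (hμ : 0 < μ) {f : ℝ → ℂ}
    (hf : Summable fun i => f (latticePoint q μ i)) :
    oscIntegral q μ f = ∑' i, f (latticePoint q μ i) := by
  have hμ' : (μ : ℂ) ≠ 0 := Complex.ofReal_ne_zero.2 hμ.ne'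
  have hq (s : ℕ) : (q : ℂ) ^ s ≠ 0 := pow_ne_zero _ (Complex.ofReal_ne_zero.2 hq0.ne')
  have h1q : (1 - (q : ℂ)) ≠ 0 := by
    rw [sub_ne_zero]
    exact_mod_cast hq1.ne'
  obtain ⟨h1, h2⟩ := summable_sum_iff.1 hf
  have hsum : ∑' i, f (latticePoint q μ i) = ∑' s, f (latticePoint q μ (.inl s)) +
      ∑' s, f (latticePoint q μ (.inr s)) :=
    Summable.tsum_sum (f := fun i => f (latticePoint q μ i)) h1 h2
  rw [hsum, oscIntegral, jackson, jacksonZero, jacksonZero]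
  have e1 : ∀ s : ℕ, f (1 * q ^ s) * ((|1 * q ^ s|⁻¹ : ℝ) : ℂ) * (q : ℂ) ^ s =
      f (latticePoint q μ (.inl s)) := fun s => by
    have hs := hq s
    rw [one_mul, abs_of_pos (by positivity), latticePoint]
    push_cast
    field_simp
  have e2 : ∀ s : ℕ, f (-μ * q ^ s) * ((|-μ * q ^ s|⁻¹ : ℝ) : ℂ) * (q : ℂ) ^ s =
      (μ : ℂ)⁻¹ * f (latticePoint q μ (.inr s)) := fun s => by
    have hs := hq s
    rw [abs_mul, abs_neg, abs_of_pos hμ, abs_of_pos (show 0 < q ^ s by positivity), latticePoint]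
    push_cast
    field_simp
  simp only [e1, e2, tsum_mul_left]
  push_cast
  field_simp
  ring

/-! ### The orthogonality measure -/

lemma weight_pos {q μ x : ℝ} (hq0 : 0 < q) (hq1 : q < 1) (hμ : 0 < μ)
    (hx : x ∈ Set.Icc (-μ) 1) : 0 < weight q μ x := by
  have h1 : q * x < 1 := by nlinarith [hx.2]
  have h2 : -(μ⁻¹ * q * x) < 1 := by
    have : -(μ⁻¹ * q * x) = q * (-x / μ) := by field_simp
    rw [this]
    have : -x / μ ≤ 1 := (div_le_one hμ).2 (by linarith [hx.1])
    nlinarith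
  have h3 : -(q / μ) < 1 := by
    have : 0 < q / μ := by positivity
    linarith
  have := qPochInf_pos hq0 hq1 h1
  have := qPochInf_pos hq0 hq1 h2
  have := qPochInf_pos hq0 hq1 h3
  have := qPochInf_pos hq0 hq1 hq1
  have := qPochInf_pos hq0 hq1 (show -μ < 1 by linarith)
  unfold weight
  positivity

/-- The `q`-Pearson equation for the weight. -/
lemma weight_eq_mul {q : ℝ} (hq0 : 0 < q) (hq1 : q < 1) (μ x : ℝ) :
    weight q μ x = (1 - q * x) * (1 + μ⁻¹ * q * x) * weight q μ (q * x) := by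
  unfold weight
  rw [qPochInf_eq_mul hq0 hq1 (q * x), qPochInf_eq_mul hq0 hq1 (-(μ⁻¹ * q * x)),
    show q * -(μ⁻¹ * q * x) = -(μ⁻¹ * q * (q * x)) by ring]
  ring

lemma tendsto_mul_pow {q : ℝ} (hq0 : 0 < q) (hq1 : q < 1) (c : ℝ) :
    Tendsto (fun s : ℕ => c * q ^ s) atTop (𝓝 0) := by
  simpa using (tendsto_pow_atTop_nhds_zero_of_lt_one hq0.le hq1).const_mul c

lemma tendsto_weight {q μ : ℝ} (hq0 : 0 < q) (hq1 : q < 1) (c : ℝ) :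
    Tendsto (fun s : ℕ => weight q μ (c * q ^ s)) atTop (𝓝 (weight q μ 0)) := by
  have h1 := tendsto_qPochInf_mul_pow hq0 hq1 (q * c)
  have h2 := tendsto_qPochInf_mul_pow hq0 hq1 (-(μ⁻¹ * q * c))
  have h0 : qPochInf 0 q = 1 := by simp [qPochInf]
  have h := (h1.mul h2).div_const (qPochInf q q * qPochInf (-μ) q * qPochInf (-(q / μ)) q)
  simp only [weight, mul_zero, neg_zero, h0]
  refine h.congr fun s => ?_
  rw [mul_assoc q c, neg_mul, mul_assoc _ c]

/-- The mass `ρ̃(x) |x|` of the orthogonality measure at a lattice point. -/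
noncomputable def mass (q μ : ℝ) (i : ℕ ⊕ ℕ) : ℝ :=
  weight q μ (latticePoint q μ i) * |latticePoint q μ i|

lemma mass_pos {q μ : ℝ} (hq0 : 0 < q) (hq1 : q < 1) (hμ : 0 < μ) (i : ℕ ⊕ ℕ) :
    0 < mass q μ i :=
  mul_pos (weight_pos hq0 hq1 hμ (latticePoint_mem_Icc hq0 hq1 hμ i))
    (abs_pos.2 (latticePoint_ne_zero hq0 hμ i))

lemma summable_weight_mul {q : ℝ} (hq0 : 0 < q) (hq1 : q < 1) (μ c : ℝ) {g : ℝ → ℝ}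
    (hg : Continuous g) :
    Summable fun s : ℕ => weight q μ (c * q ^ s) * |c * q ^ s| * g (c * q ^ s) := by
  have hlim : Tendsto (fun s : ℕ => weight q μ (c * q ^ s) * g (c * q ^ s)) atTop
      (𝓝 (weight q μ 0 * g 0)) :=
    (tendsto_weight hq0 hq1 c).mul ((hg.tendsto 0).comp (tendsto_mul_pow hq0 hq1 c))
  obtain ⟨B, hB⟩ := hlim.norm.bddAbove_range
  refine (((summable_geometric_of_lt_one hq0.le hq1).mul_left |c|).mul_left B).of_norm_bounded
    fun s => ?_
  rw [mul_right_comm, norm_mul, norm_abs_eq_norm, Real.norm_eq_abs (c * q ^ s), abs_mul,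
    abs_of_pos (show 0 < q ^ s by positivity)]
  exact mul_le_mul_of_nonneg_right (hB ⟨s, rfl⟩) (by positivity)

lemma summable_mass_mul {q : ℝ} (hq0 : 0 < q) (hq1 : q < 1) (μ : ℝ) {g : ℝ → ℝ}
    (hg : Continuous g) : Summable fun i => mass q μ i * g (latticePoint q μ i) := by
  refine Summable.sum _ ?_ ?_
  · simpa [Function.comp_def, mass, latticePoint] using summable_weight_mul hq0 hq1 μ 1 hg
  · exact summable_weight_mul hq0 hq1 μ (-μ) hg

lemma hasSum_weight_mul_alSalamCarlitz {q μ : ℝ} (hq0 : 0 < q) (hq1 : q < 1) (hμ : 0 < μ)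
    {c : ℝ} (hc : c = 1 ∨ c = -μ) (n : ℕ) :
    HasSum (fun s : ℕ => weight q μ (c * q ^ s) * (c * q ^ s)
      * alSalamCarlitz q μ (c * q ^ s) (n + 1)) (weight q μ 0 * alSalamCarlitz q μ 0 n) := by
  have hend : c * alSalamCarlitz q μ c (n + 1) = alSalamCarlitz q μ c n := by
    rcases hc with rfl | rfl
    · simp [alSalamCarlitz_one_right hq0 hμ]
    · rw [alSalamCarlitz_neg_right hq0 hμ, alSalamCarlitz_neg_right hq0 hμ]
      rw [pow_succ', ← mul_assoc, neg_mul_neg, mul_inv_cancel₀ hμ.ne', one_mul]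
  -- The raising relation and the Pearson equation make the sum telescope.
  have hpartial : ∀ N : ℕ, ∑ s ∈ Finset.range (N + 1), weight q μ (c * q ^ s) * (c * q ^ s)
      * alSalamCarlitz q μ (c * q ^ s) (n + 1) =
      weight q μ (c * q ^ N) * alSalamCarlitz q μ (c * q ^ N) n := by
    intro N
    induction N with
    | zero => simp [mul_assoc, hend]
    | succ N ih =>
      have hr := alSalamCarlitz_raise hq0 hμ (c * q ^ N) n
      have hw := weight_eq_mul hq0 hq1 μ (c * q ^ N)
      rw [Finset.sum_range_succ, ih, show c * q ^ (N + 1) = q * (c * q ^ N) by ring, hw]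
      linear_combination weight q μ (q * (c * q ^ N)) * hr
  have hsum : Summable (fun s : ℕ => weight q μ (c * q ^ s) * (c * q ^ s)
      * alSalamCarlitz q μ (c * q ^ s) (n + 1)) := by
    have h := summable_weight_mul hq0 hq1 μ c (continuous_alSalamCarlitz q μ (n + 1))
    refine h.abs.of_norm_bounded fun s => le_of_eq ?_
    simp only [Real.norm_eq_abs, abs_mul, abs_abs]
  have hlim : Tendsto (fun N : ℕ => weight q μ (c * q ^ N) * alSalamCarlitz q μ (c * q ^ N) n)
      atTop (𝓝 (weight q μ 0 * alSalamCarlitz q μ 0 n)) :=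
    (tendsto_weight hq0 hq1 c).mul
      (((continuous_alSalamCarlitz q μ n).tendsto 0).comp (tendsto_mul_pow hq0 hq1 c))
  have h := (tendsto_add_atTop_iff_nat 1).2 hsum.hasSum.tendsto_sum_nat
  rw [← tendsto_nhds_unique (h.congr hpartial) hlim]
  exact hsum.hasSum

/-- The polynomials `u_{n+1}` are orthogonal to `u_0 = 1`: both branches of the lattice contribute
the same limit at `0`, with opposite signs because of the absolute value in the masses. -/
lemma tsum_mass_mul_alSalamCarlitz_succ {q μ : ℝ} (hq0 : 0 < q) (hq1 : q < 1) (hμ : 0 < μ)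
    (n : ℕ) : ∑' i, mass q μ i * alSalamCarlitz q μ (latticePoint q μ i) (n + 1) = 0 := by
  have h1 := hasSum_weight_mul_alSalamCarlitz hq0 hq1 hμ (.inl rfl) n
  have h2 := hasSum_weight_mul_alSalamCarlitz hq0 hq1 hμ (.inr rfl) n
  have h : HasSum (fun i => mass q μ i * alSalamCarlitz q μ (latticePoint q μ i) (n + 1))
      (weight q μ 0 * alSalamCarlitz q μ 0 n + -(weight q μ 0 * alSalamCarlitz q μ 0 n)) := by
    refine HasSum.sum ?_ ?_
    · refine h1.congr_fun fun s => ?_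
      have hs : 0 < q ^ s := by positivity
      simp [mass, latticePoint, abs_of_pos hs]
    · refine h2.neg.congr_fun fun s => ?_
      have hs : 0 < μ * q ^ s := by positivity
      simp only [mass, latticePoint, Function.comp, neg_mul, abs_neg, abs_of_pos hs]
      ring
  rw [h.tsum_eq, add_neg_cancel]

/-- The bilinear form `∑ ρ̃(x) |x| u_m(x) u_n(x)` over the lattice. -/
noncomputable def massForm (q μ : ℝ) (m n : ℕ) : ℝ :=
  ∑' i, mass q μ i * (alSalamCarlitz q μ (latticePoint q μ i) m
    * alSalamCarlitz q μ (latticePoint q μ i) n)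

lemma summable_massForm {q : ℝ} (hq0 : 0 < q) (hq1 : q < 1) (μ : ℝ) (m n : ℕ) :
    Summable fun i => mass q μ i * (alSalamCarlitz q μ (latticePoint q μ i) m
      * alSalamCarlitz q μ (latticePoint q μ i) n) :=
  summable_mass_mul hq0 hq1 μ
    ((continuous_alSalamCarlitz q μ m).mul (continuous_alSalamCarlitz q μ n))

lemma massForm_comm (q μ : ℝ) (m n : ℕ) : massForm q μ m n = massForm q μ n m :=
  tsum_congr fun _ => by rw [mul_comm (alSalamCarlitz _ _ _ m)]

/-- The three-term recurrence for the multiplication by `x`, in the first argument. -/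
lemma massForm_recurrence_left {q μ : ℝ} (hq0 : 0 < q) (hq1 : q < 1) (hμ : 0 < μ) (m n : ℕ) :
    ∑' i, mass q μ i * (latticePoint q μ i * (alSalamCarlitz q μ (latticePoint q μ i) m
        * alSalamCarlitz q μ (latticePoint q μ i) n)) =
      μ * q ^ m * massForm q μ (m + 1) n + (1 - q ^ m) * massForm q μ (m - 1) n
        + (1 - μ) * q ^ m * massForm q μ m n := by
  have hs := fun k => summable_massForm hq0 hq1 μ k n
  simp only [massForm]
  rw [← tsum_mul_left, ← tsum_mul_left, ← tsum_mul_left,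
    ← ((hs (m + 1)).mul_left _).tsum_add ((hs (m - 1)).mul_left _),
    ← (((hs (m + 1)).mul_left _).add ((hs (m - 1)).mul_left _)).tsum_add ((hs m).mul_left _)]
  refine tsum_congr fun i => ?_
  rw [← mul_assoc (latticePoint q μ i), mul_alSalamCarlitz hq0 hμ]
  ring

/-- Multiplication by `x` is symmetric for the bilinear form. -/
lemma massForm_recurrence {q μ : ℝ} (hq0 : 0 < q) (hq1 : q < 1) (hμ : 0 < μ) (m n : ℕ) :
    μ * q ^ m * massForm q μ (m + 1) n + (1 - q ^ m) * massForm q μ (m - 1) n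
        + (1 - μ) * q ^ m * massForm q μ m n =
      μ * q ^ n * massForm q μ m (n + 1) + (1 - q ^ n) * massForm q μ m (n - 1)
        + (1 - μ) * q ^ n * massForm q μ m n := by
  rw [← massForm_recurrence_left hq0 hq1 hμ, massForm_comm q μ m (n + 1),
    massForm_comm q μ m (n - 1), massForm_comm q μ m n, ← massForm_recurrence_left hq0 hq1 hμ]
  exact tsum_congr fun _ => by rw [mul_comm (alSalamCarlitz _ _ _ m)]

lemma massForm_eq_zero_of_lt {q μ : ℝ} (hq0 : 0 < q) (hq1 : q < 1) (hμ : 0 < μ) (m : ℕ) :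
    ∀ n, m < n → massForm q μ m n = 0 := by
  induction m using Nat.strong_induction_on with
  | _ m ih =>
    intro n hn
    rcases m with _ | m
    · obtain ⟨n, rfl⟩ := Nat.exists_eq_succ_of_ne_zero hn.ne'
      simpa [massForm, alSalamCarlitz] using tsum_mass_mul_alSalamCarlitz_succ hq0 hq1 hμ n
    · have h := massForm_recurrence hq0 hq1 hμ m n
      rw [ih (m - 1) (by omega) n (by omega), ih m (by omega) n (by omega),
        ih m (by omega) (n + 1) (by omega), ih m (by omega) (n - 1) (by omega)] at h
      have : μ * q ^ m ≠ 0 := by positivity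
      simpa [this, hμ.ne', hq0.ne'] using h

lemma massForm_self {q μ : ℝ} (hq0 : 0 < q) (hq1 : q < 1) (hμ : 0 < μ) (n : ℕ) :
    massForm q μ n n = normSq q μ n * ∑' i, mass q μ i := by
  induction n with
  | zero => simp [massForm, alSalamCarlitz, normSq_zero]
  | succ n ih =>
    have h := massForm_recurrence hq0 hq1 hμ n (n + 1)
    rw [massForm_eq_zero_of_lt hq0 hq1 hμ (n - 1) (n + 1) (by omega),
      massForm_eq_zero_of_lt hq0 hq1 hμ n (n + 1) (by omega),
      massForm_eq_zero_of_lt hq0 hq1 hμ n (n + 1 + 1) (by omega), Nat.add_sub_cancel, ih] at h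
    have h0 : 0 < μ * q ^ n := by positivity
    rw [normSq_succ hq0 hμ]
    field_simp
    linear_combination h

/-! ### The wave functions as a Hilbert basis -/

lemma memℓp_two_iff {ι : Type*} {f : ι → ℂ} :
    Memℓp f 2 ↔ Summable fun i => ‖f i‖ ^ 2 := by
  rw [memℓp_gen_iff (by norm_num)]
  norm_num

lemma oscSquareIntegrable_iff {q μ : ℝ} (hq0 : 0 < q) (hμ : 0 < μ) {f : ℝ → ℂ} :
    OscSquareIntegrable q μ f ↔ Memℓp (fun i => f (latticePoint q μ i)) 2 := by
  rw [OscSquareIntegrable, oscIntegrable_iff hq0 hμ, memℓp_two_iff]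
  exact Complex.summable_ofReal

lemma waveFun_latticePoint (q μ : ℝ) (n : ℕ) (i : ℕ ⊕ ℕ) :
    waveFun q μ n (latticePoint q μ i) =
      (√(normSq q μ n))⁻¹ * √(mass q μ i) * alSalamCarlitz q μ (latticePoint q μ i) n := rfl

lemma hasSum_waveFun_mul_waveFun {q μ : ℝ} (hq0 : 0 < q) (hq1 : q < 1) (hμ : 0 < μ) (m n : ℕ) :
    HasSum (fun i => waveFun q μ m (latticePoint q μ i) * waveFun q μ n (latticePoint q μ i))
      (if m = n then ∑' i, mass q μ i else 0) := by
  have h := (summable_massForm hq0 hq1 μ m n).hasSum.mul_left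
    ((√(normSq q μ m))⁻¹ * (√(normSq q μ n))⁻¹)
  have hval : (√(normSq q μ m))⁻¹ * (√(normSq q μ n))⁻¹ * massForm q μ m n =
      if m = n then ∑' i, mass q μ i else 0 := by
    rcases lt_trichotomy m n with hmn | rfl | hmn
    · rw [massForm_eq_zero_of_lt hq0 hq1 hμ m n hmn, if_neg hmn.ne, mul_zero]
    · have hd := normSq_pos hq0 hq1 hμ m
      rw [if_pos rfl, massForm_self hq0 hq1 hμ, ← mul_inv, Real.mul_self_sqrt hd.le,
        inv_mul_cancel_left₀ hd.ne']
    · rw [massForm_comm, massForm_eq_zero_of_lt hq0 hq1 hμ n m hmn, if_neg hmn.ne', mul_zero]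
  rw [← hval]
  refine h.congr_fun fun i => ?_
  have hm := Real.mul_self_sqrt (mass_pos hq0 hq1 hμ i).le
  rw [waveFun_latticePoint, waveFun_latticePoint]
  linear_combination (√(normSq q μ m))⁻¹ * (√(normSq q μ n))⁻¹
    * alSalamCarlitz q μ (latticePoint q μ i) m * alSalamCarlitz q μ (latticePoint q μ i) n * hm

/-- A sequence in `ℓ²` orthogonal to all wave functions vanishes: multiplied by the square root of
the mass it has vanishing moments. -/
lemma eq_zero_of_tsum_waveFun_mul_eq_zero {q μ : ℝ} (hq0 : 0 < q) (hq1 : q < 1) (hμ : 0 < μ)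
    {f : ℕ ⊕ ℕ → ℂ} (hf : Memℓp f 2)
    (h : ∀ n, ∑' i, (waveFun q μ n (latticePoint q μ i) : ℂ) * f i = 0) (i : ℕ ⊕ ℕ) :
    f i = 0 := by
  have hms : Summable fun i => mass q μ i := by
    simpa using summable_mass_mul hq0 hq1 μ (g := fun _ => 1) continuous_const
  have hg : Summable fun i => ‖((√(mass q μ i) : ℝ) : ℂ) * f i‖ := by
    refine ((hms.add (memℓp_two_iff.1 hf))).of_norm_bounded fun i => ?_
    rw [norm_norm, norm_mul, Complex.norm_real, Real.norm_of_nonneg (Real.sqrt_nonneg _)]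
    have h1 := Real.sq_sqrt (mass_pos hq0 hq1 hμ i).le
    nlinarith [sq_nonneg (√(mass q μ i) - ‖f i‖), sq_nonneg (√(mass q μ i)), sq_nonneg ‖f i‖]
  have hgb : ∀ φ : ℝ → ℝ, Continuous φ → Summable fun i =>
      (((√(mass q μ i) : ℝ) : ℂ) * f i) * (φ (latticePoint q μ i) : ℂ) := by
    intro φ hφ
    obtain ⟨B, hB⟩ := isCompact_Icc.exists_bound_of_continuousOn
      (hφ.continuousOn (s := Set.Icc (-μ) 1))
    refine (hg.mul_right B).of_norm_bounded fun i => ?_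
    rw [norm_mul, Complex.norm_real]
    exact mul_le_mul_of_nonneg_left (hB _ (latticePoint_mem_Icc hq0 hq1 hμ i)) (norm_nonneg _)
  -- The three-term recurrence raises the power `k`; the case `n = 0` gives the moments.
  have hmom : ∀ k n : ℕ, ∑' i, (((√(mass q μ i) : ℝ) : ℂ) * f i) *
      ((latticePoint q μ i ^ k * alSalamCarlitz q μ (latticePoint q μ i) n : ℝ) : ℂ) = 0 := by
    intro k
    induction k with
    | zero =>
      intro n
      have hd : ((√(normSq q μ n) : ℝ) : ℂ) ≠ 0 :=
        Complex.ofReal_ne_zero.2 (Real.sqrt_pos.2 (normSq_pos hq0 hq1 hμ n)).ne'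
      rw [← mul_zero ((√(normSq q μ n) : ℝ) : ℂ), ← h n, ← tsum_mul_left]
      refine tsum_congr fun i => ?_
      rw [waveFun_latticePoint]
      push_cast
      field_simp
    | succ k ih =>
      intro n
      have hs : ∀ n, Summable fun i => (((√(mass q μ i) : ℝ) : ℂ) * f i) *
          ((latticePoint q μ i ^ k * alSalamCarlitz q μ (latticePoint q μ i) n : ℝ) : ℂ) :=
        fun n => hgb (fun x => x ^ k * alSalamCarlitz q μ x n)
          ((continuous_pow k).mul (continuous_alSalamCarlitz q μ n))
      have hsum := (((hs (n + 1)).hasSum.mul_left ((μ * q ^ n : ℝ) : ℂ)).add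
        ((hs (n - 1)).hasSum.mul_left ((1 - q ^ n : ℝ) : ℂ))).add
        ((hs n).hasSum.mul_left (((1 - μ) * q ^ n : ℝ) : ℂ))
      rw [ih, ih, ih, mul_zero, mul_zero, mul_zero, add_zero, add_zero] at hsum
      rw [← hsum.tsum_eq]
      refine tsum_congr fun i => ?_
      rw [pow_succ, mul_assoc (latticePoint q μ i ^ k), mul_alSalamCarlitz hq0 hμ]
      push_cast
      ring
  have h0 := eq_zero_of_moments_eq_zero hg (latticePoint_injective hq0 hq1 hμ)
    (latticePoint_mem_Icc hq0 hq1 hμ)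
    (fun k => by simpa [alSalamCarlitz] using hmom k 0) i
  exact (mul_eq_zero.1 h0).resolve_left
    (Complex.ofReal_ne_zero.2 (Real.sqrt_pos.2 (mass_pos hq0 hq1 hμ i)).ne')

/-- The wave functions, restricted to the lattice, form a Hilbert basis of `ℓ²`. That the
orthogonality measure has total mass one is read off from Parseval's identity for the unit vector
at the point `1`, where `u_n(1) = 1`, and Euler's identity. -/
lemma exists_hilbertBasis_waveFun {q μ : ℝ} (hq0 : 0 < q) (hq1 : q < 1) (hμ : 0 < μ) :
    ∃ b : HilbertBasis ℕ ℂ ℓ²(ℕ ⊕ ℕ, ℂ),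
      ∀ n i, b n i = (waveFun q μ n (latticePoint q μ i) : ℂ) := by
  set M := ∑' i, mass q μ i
  have hms : Summable fun i => mass q μ i := by
    simpa using summable_mass_mul hq0 hq1 μ (g := fun _ => 1) continuous_const
  have hMpos : 0 < M := hms.tsum_pos (fun i => (mass_pos hq0 hq1 hμ i).le) (.inl 0)
    (mass_pos hq0 hq1 hμ _)
  have hMs : ((√M : ℝ) : ℂ) ≠ 0 := Complex.ofReal_ne_zero.2 (Real.sqrt_pos.2 hMpos).ne'
  have hMM : ((√M : ℝ) : ℂ) * ((√M : ℝ) : ℂ) = (M : ℂ) := by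
    rw [← Complex.ofReal_mul, Real.mul_self_sqrt hMpos.le]
  -- The mass `M` is not yet known to be one, so the wave functions are first divided by `√M`.
  let f : ℕ → ℕ ⊕ ℕ → ℂ := fun n i => ((√M : ℝ) : ℂ)⁻¹ * (waveFun q μ n (latticePoint q μ i) : ℂ)
  have hf : ∀ n, Memℓp (f n) 2 := by
    intro n
    rw [memℓp_two_iff]
    refine ((hasSum_waveFun_mul_waveFun hq0 hq1 hμ n n).summable.mul_left (√M)⁻¹ |>.mul_left
      (√M)⁻¹).congr fun i => ?_
    simp only [f]
    rw [← Complex.ofReal_inv, ← Complex.ofReal_mul, Complex.norm_real, Real.norm_eq_abs, sq_abs]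
    ring
  let e : ℕ → ℓ²(ℕ ⊕ ℕ, ℂ) := fun n => ⟨f n, hf n⟩
  have he : ∀ n i, e n i = ((√M : ℝ) : ℂ)⁻¹ * (waveFun q μ n (latticePoint q μ i) : ℂ) :=
    fun n i => rfl
  have hinner : ∀ n (v : ℓ²(ℕ ⊕ ℕ, ℂ)), ⟪e n, v⟫_ℂ =
      ((√M : ℝ) : ℂ)⁻¹ * ∑' i, (waveFun q μ n (latticePoint q μ i) : ℂ) * v i := by
    intro n v
    rw [lp.inner_eq_tsum, ← tsum_mul_left]
    refine tsum_congr fun i => ?_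
    rw [he, RCLike.inner_apply, ← Complex.ofReal_inv, ← Complex.ofReal_mul, Complex.conj_ofReal]
    push_cast
    ring
  have hon : Orthonormal ℂ e := by
    rw [orthonormal_iff_ite]
    intro m n
    have h := Complex.hasSum_ofReal.2 (hasSum_waveFun_mul_waveFun hq0 hq1 hμ m n)
    rw [hinner]
    have h2 : ∑' i, (waveFun q μ m (latticePoint q μ i) : ℂ) * e n i =
        ((√M : ℝ) : ℂ)⁻¹ * ((if m = n then M else 0 : ℝ) : ℂ) := by
      rw [← h.tsum_eq, ← tsum_mul_left]
      refine tsum_congr fun i => ?_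
      rw [he]
      push_cast
      ring
    rw [h2]
    split_ifs with hmn
    · rw [← hMM]
      field_simp
    · simp
  have hbot : (Submodule.span ℂ (Set.range e))ᗮ = ⊥ := by
    rw [Submodule.eq_bot_iff]
    intro v hv
    ext i
    refine eq_zero_of_tsum_waveFun_mul_eq_zero hq0 hq1 hμ (lp.memℓp v) (fun n => ?_) i
    have h := Submodule.mem_orthogonal _ v |>.1 hv (e n) (Submodule.subset_span ⟨n, rfl⟩)
    rw [hinner] at h
    exact (mul_eq_zero.1 h).resolve_left (inv_ne_zero hMs)
  let b := HilbertBasis.mkOfOrthogonalEqBot hon hbot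
  have hb : ∀ n, b n = e n := fun n =>
    congrFun (HilbertBasis.coe_mkOfOrthogonalEqBot hon hbot) n
  have hM1 : M = 1 := by
    have hpars := b.hasSum_inner_mul_inner (lp.single 2 (.inl 0) (1 : ℂ))
      (lp.single 2 (.inl 0) (1 : ℂ))
    have hterm : ∀ n, ⟪(lp.single 2 (.inl 0) (1 : ℂ) : ℓ²(ℕ ⊕ ℕ, ℂ)), b n⟫_ℂ *
        ⟪b n, lp.single 2 (.inl 0) (1 : ℂ)⟫_ℂ =
        ((M⁻¹ * mass q μ (.inl 0) * (normSq q μ n)⁻¹ : ℝ) : ℂ) := by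
      intro n
      have h1 : waveFun q μ n (latticePoint q μ (.inl 0)) =
          (√(normSq q μ n))⁻¹ * √(mass q μ (.inl 0)) := by
        rw [waveFun_latticePoint, latticePoint, pow_zero, alSalamCarlitz_one_right hq0 hμ, mul_one]
      rw [lp.inner_single_left, lp.inner_single_right, hb, he, h1, RCLike.inner_apply,
        RCLike.inner_apply, ← Complex.ofReal_inv, ← Complex.ofReal_mul, Complex.conj_ofReal,
        map_one, mul_one, one_mul, ← Complex.ofReal_mul]
      congr 1
      have a1 := Real.mul_self_sqrt hMpos.le
      have a2 := Real.mul_self_sqrt (mass_pos hq0 hq1 hμ (.inl 0)).le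
      have a3 := Real.mul_self_sqrt (normSq_pos hq0 hq1 hμ n).le
      rw [← a1, ← a3, mul_inv, mul_inv, a1, a3]
      linear_combination (√M)⁻¹ * (√M)⁻¹ * (√(normSq q μ n))⁻¹ * (√(normSq q μ n))⁻¹ * a2
    simp only [hterm] at hpars
    rw [lp.inner_single_left, lp.single_apply_self, RCLike.inner_apply, map_one, mul_one,
      ← Complex.ofReal_one, Complex.hasSum_ofReal] at hpars
    have heuler := (summable_inv_normSq hq0 hq1 hμ).hasSum.mul_left (M⁻¹ * mass q μ (.inl 0))
    rw [tsum_inv_normSq hq0 hq1 hμ] at heuler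
    have huniq := hpars.unique heuler
    have hmass : mass q μ (.inl 0) = (qPochInf (-μ) q)⁻¹ := by
      have p1 := qPochInf_pos hq0 hq1 hq1
      have p2 := qPochInf_pos hq0 hq1 (show -(q / μ) < 1 by
        have : 0 < q / μ := by positivity
        linarith)
      have p3 := qPochInf_pos hq0 hq1 (show -μ < 1 by linarith)
      rw [mass, latticePoint, pow_zero, abs_one, mul_one, weight, mul_one, mul_one,
        show μ⁻¹ * q = q / μ by ring]
      field_simp
    have p3 := qPochInf_pos hq0 hq1 (show -μ < 1 by linarith)
    rw [hmass, mul_assoc, inv_mul_cancel₀ p3.ne', mul_one] at huniq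
    exact (inv_eq_one.1 huniq.symm)
  refine ⟨b, fun n i => ?_⟩
  rw [hb, he, hM1]
  simp

/-! ### The kernel in `ℓ²` -/

lemma summable_norm_pow_mul_waveFun {q μ : ℝ} (hq0 : 0 < q) (hq1 : q < 1) (hμ : 0 < μ) (t : ℂ)
    (i : ℕ ⊕ ℕ) :
    Summable fun n : ℕ => ‖t ^ n * (waveFun q μ n (latticePoint q μ i) : ℂ)‖ := by
  obtain ⟨C, R, hC, hR, h⟩ : ∃ C R : ℝ, 0 < C ∧ 0 < R ∧
      ∀ n, |alSalamCarlitz q μ (latticePoint q μ i) n| ≤ C * R ^ n := by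
    rcases i with s | s
    · simpa [latticePoint] using exists_alSalamCarlitz_le hq0 hq1 hμ (.inl rfl) s
    · exact exists_alSalamCarlitz_le hq0 hq1 hμ (.inr rfl) s
  have hs := (summable_pow_mul_inv_sqrt_normSq hq0 hq1 hμ
    (show 0 < (‖t‖ + 1) * R by positivity)).mul_left (√(mass q μ i) * C)
  refine hs.of_norm_bounded fun n => ?_
  rw [norm_norm, norm_mul, norm_pow, Complex.norm_real, waveFun_latticePoint, norm_mul, norm_mul,
    Real.norm_of_nonneg (inv_nonneg.2 (Real.sqrt_nonneg _)),
    Real.norm_of_nonneg (Real.sqrt_nonneg _), Real.norm_eq_abs, mul_pow]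
  calc ‖t‖ ^ n * ((√(normSq q μ n))⁻¹ * √(mass q μ i)
        * |alSalamCarlitz q μ (latticePoint q μ i) n|)
      ≤ (‖t‖ + 1) ^ n * ((√(normSq q μ n))⁻¹ * √(mass q μ i) * (C * R ^ n)) := by
        gcongr
        · linarith
        · exact h n
    _ = √(mass q μ i) * C * ((‖t‖ + 1) ^ n * R ^ n * (√(normSq q μ n))⁻¹) := by ring

section HilbertBasis

variable {q μ : ℝ} {b : HilbertBasis ℕ ℂ ℓ²(ℕ ⊕ ℕ, ℂ)}

lemma inner_basis_single (hb : ∀ n i, b n i = (waveFun q μ n (latticePoint q μ i) : ℂ))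
    (n : ℕ) (i : ℕ ⊕ ℕ) :
    ⟪b n, lp.single 2 i (1 : ℂ)⟫_ℂ = (waveFun q μ n (latticePoint q μ i) : ℂ) := by
  rw [lp.inner_single_right, hb, RCLike.inner_apply, Complex.conj_ofReal, one_mul]

/-- Coordinates at the lattice points in terms of Fourier coefficients. -/
lemma hasSum_waveFun_mul_inner (hb : ∀ n i, b n i = (waveFun q μ n (latticePoint q μ i) : ℂ))
    (v : ℓ²(ℕ ⊕ ℕ, ℂ)) (i : ℕ ⊕ ℕ) :
    HasSum (fun n => (waveFun q μ n (latticePoint q μ i) : ℂ) * ⟪b n, v⟫_ℂ) (v i) := by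
  have h := b.hasSum_inner_mul_inner (lp.single 2 i (1 : ℂ)) v
  rw [lp.inner_single_left, RCLike.inner_apply, map_one, mul_one] at h
  refine h.congr_fun fun n => ?_
  rw [← inner_conj_symm _ (b n), inner_basis_single hb, Complex.conj_ofReal]

/-- For a fixed lattice point `x` the function `K_t(x, ·)` lies in `ℓ²`, with Fourier
coefficients `t^n ψ̃_n(x)`. -/
lemma exists_kernel_vector (hq0 : 0 < q) (hq1 : q < 1) (hμ : 0 < μ)
    (hb : ∀ n i, b n i = (waveFun q μ n (latticePoint q μ i) : ℂ)) (t : ℂ) (i : ℕ ⊕ ℕ) :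
    ∃ k : ℓ²(ℕ ⊕ ℕ, ℂ),
      (∀ j, HasSum (kernelTerm q μ t (latticePoint q μ i) (latticePoint q μ j)) (k j)) ∧
      ∀ n, ⟪b n, k⟫_ℂ = t ^ n * (waveFun q μ n (latticePoint q μ i) : ℂ) := by
  have hs : Summable fun n : ℕ => (t ^ n * (waveFun q μ n (latticePoint q μ i) : ℂ)) • b n := by
    refine (summable_norm_pow_mul_waveFun hq0 hq1 hμ t i).of_norm_bounded fun n => ?_
    rw [norm_smul, b.orthonormal.1, mul_one]
  obtain ⟨k, hk⟩ := hs
  have hcoef : ∀ n, ⟪b n, k⟫_ℂ = t ^ n * (waveFun q μ n (latticePoint q μ i) : ℂ) := by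
    intro n
    have h := hk.mapL (innerSL ℂ (b n))
    refine h.unique ?_
    refine (hasSum_ite_eq n (t ^ n * (waveFun q μ n (latticePoint q μ i) : ℂ))).congr_fun
      fun m => ?_
    rw [innerSL_apply_apply, inner_smul_right, orthonormal_iff_ite.1 b.orthonormal]
    by_cases h : m = n
    · subst h; simp
    · simp [h, Ne.symm h]
  refine ⟨k, fun j => (hasSum_waveFun_mul_inner hb k j).congr_fun fun n => ?_, hcoef⟩
  rw [hcoef, kernelTerm]
  ring

lemma conj_kernel (q μ : ℝ) (t : ℂ) (x y : ℝ) :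
    conj (kernel q μ t x y) = kernel q μ (conj t) x y := by
  rw [kernel, kernel, Complex.conj_tsum]
  exact tsum_congr fun n => by simp [kernelTerm]

/-- The operator with kernel `K_t` multiplies the `n`-th Fourier coefficient by `t^n`. -/
lemma hasSum_kernel_mul (hq0 : 0 < q) (hq1 : q < 1) (hμ : 0 < μ)
    (hb : ∀ n i, b n i = (waveFun q μ n (latticePoint q μ i) : ℂ)) (t : ℂ) (i : ℕ ⊕ ℕ)
    (v : ℓ²(ℕ ⊕ ℕ, ℂ)) :
    HasSum (fun j => kernel q μ t (latticePoint q μ i) (latticePoint q μ j) * v j)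
      (∑' n, t ^ n * (waveFun q μ n (latticePoint q μ i) : ℂ) * ⟪b n, v⟫_ℂ) := by
  obtain ⟨k, hk, hcoef⟩ := exists_kernel_vector hq0 hq1 hμ hb (conj t) i
  have h := lp.hasSum_inner (𝕜 := ℂ) k v
  rw [← b.tsum_inner_mul_inner k v] at h
  have hval : ∑' n, ⟪k, b n⟫_ℂ * ⟪b n, v⟫_ℂ =
      ∑' n, t ^ n * (waveFun q μ n (latticePoint q μ i) : ℂ) * ⟪b n, v⟫_ℂ := by
    refine tsum_congr fun n => ?_
    rw [← inner_conj_symm k, hcoef, map_mul, map_pow, Complex.conj_conj, Complex.conj_ofReal]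
  rw [hval] at h
  refine h.congr_fun fun j => ?_
  rw [RCLike.inner_apply, ← (hk j).tsum_eq]
  change _ = v j * conj (kernel q μ (conj t) _ _)
  rw [conj_kernel, Complex.conj_conj, mul_comm]

/-- The kernel `K_1` is the identity: this is the completeness of the wave functions. -/
lemma kernel_one (hq0 : 0 < q) (hq1 : q < 1) (hμ : 0 < μ)
    (hb : ∀ n i, b n i = (waveFun q μ n (latticePoint q μ i) : ℂ)) (i j : ℕ ⊕ ℕ) :
    kernel q μ 1 (latticePoint q μ i) (latticePoint q μ j) =
      if latticePoint q μ i = latticePoint q μ j then 1 else 0 := by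
  have h := hasSum_waveFun_mul_inner hb (lp.single 2 j (1 : ℂ)) i
  simp only [(latticePoint_injective hq0 hq1 hμ).eq_iff, kernel]
  have hval : (lp.single 2 j (1 : ℂ) : ℓ²(ℕ ⊕ ℕ, ℂ)) i = if i = j then 1 else 0 := by
    rw [lp.single_apply, Pi.single_apply]
  rw [← hval, ← h.tsum_eq]
  refine tsum_congr fun n => ?_
  rw [inner_basis_single hb, kernelTerm, one_pow, one_mul]

/-! ### The integral operators -/

/-- `hasSum_kernel_mul` for the `q`-integral of a function that represents an `ℓ²` vector. -/
lemma oscIntegral_kernel_mul (hq0 : 0 < q) (hq1 : q < 1) (hμ : 0 < μ)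
    (hb : ∀ n i, b n i = (waveFun q μ n (latticePoint q μ i) : ℂ))
    (t : ℂ) (i : ℕ ⊕ ℕ) (v : ℓ²(ℕ ⊕ ℕ, ℂ)) {g : ℝ → ℂ} (hg : ∀ j, g (latticePoint q μ j) = v j) :
    OscIntegrable q μ (fun y => kernel q μ t (latticePoint q μ i) y * g y) ∧
      oscIntegral q μ (fun y => kernel q μ t (latticePoint q μ i) y * g y) =
        ∑' n, t ^ n * (waveFun q μ n (latticePoint q μ i) : ℂ) * ⟪b n, v⟫_ℂ := by
  have h := hasSum_kernel_mul hq0 hq1 hμ hb t i v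
  simp only [← hg] at h
  set f : ℝ → ℂ := fun y => kernel q μ t (latticePoint q μ i) y * g y
  have hs : Summable fun j => f (latticePoint q μ j) := h.summable
  rw [oscIntegrable_iff hq0 hμ, oscIntegral_eq_tsum hq0 hq1 hμ hs]
  exact ⟨hs, h.tsum_eq⟩

lemma qTransform_waveFun (hq0 : 0 < q) (hq1 : q < 1) (hμ : 0 < μ)
    (hb : ∀ n i, b n i = (waveFun q μ n (latticePoint q μ i) : ℂ))
    (t : ℂ) (m : ℕ) {x : ℝ} (hx : x ∈ lattice q μ) :
    OscIntegrable q μ (fun y => kernel q μ t x y * (waveFun q μ m y : ℂ)) ∧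
      t ^ m * (waveFun q μ m x : ℂ) =
        qTransform q μ t (fun y => (waveFun q μ m y : ℂ)) x := by
  obtain ⟨i, rfl⟩ := mem_lattice_iff.1 hx
  obtain ⟨h1, h2⟩ := oscIntegral_kernel_mul hq0 hq1 hμ hb t i (b m)
    (g := fun y => (waveFun q μ m y : ℂ)) fun j => (hb m j).symm
  refine ⟨h1, ?_⟩
  rw [qTransform, h2, tsum_eq_single m]
  · rw [inner_self_eq_norm_sq_to_K, b.orthonormal.1]
    simp
  · intro n hn
    rw [b.orthonormal.2 hn, mul_zero]

lemma oscIntegral_kernel_mul_kernel (hq0 : 0 < q) (hq1 : q < 1) (hμ : 0 < μ)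
    (hb : ∀ n i, b n i = (waveFun q μ n (latticePoint q μ i) : ℂ))
    (t t' : ℂ) {x x' : ℝ} (hx : x ∈ lattice q μ) (hx' : x' ∈ lattice q μ) :
    OscIntegrable q μ (fun y => kernel q μ t x y * kernel q μ t' x' y) ∧
      oscIntegral q μ (fun y => kernel q μ t x y * kernel q μ t' x' y) =
        kernel q μ (t * t') x x' := by
  obtain ⟨i, rfl⟩ := mem_lattice_iff.1 hx
  obtain ⟨i', rfl⟩ := mem_lattice_iff.1 hx'
  obtain ⟨k, hk, hcoef⟩ := exists_kernel_vector hq0 hq1 hμ hb t' i'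
  obtain ⟨h1, h2⟩ := oscIntegral_kernel_mul hq0 hq1 hμ hb t i k
    (g := fun y => kernel q μ t' (latticePoint q μ i') y) fun j => (hk j).tsum_eq
  refine ⟨h1, h2.trans (tsum_congr fun n => ?_)⟩
  rw [hcoef, kernelTerm, mul_pow]
  ring

/-- If `f` is represented by `v ∈ ℓ²`, then `F f` is represented by the vector with the Fourier
coefficients `i^n ⟪ψ̃_n, v⟫`, which is square summable because `|i^n| = 1`. -/
lemma exists_vector_qTransform (hq0 : 0 < q) (hq1 : q < 1) (hμ : 0 < μ)
    (hb : ∀ n i, b n i = (waveFun q μ n (latticePoint q μ i) : ℂ))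
    {f : ℝ → ℂ} {v : ℓ²(ℕ ⊕ ℕ, ℂ)} (hv : ∀ j, f (latticePoint q μ j) = v j) :
    ∃ w : ℓ²(ℕ ⊕ ℕ, ℂ), (∀ n, ⟪b n, w⟫_ℂ = Complex.I ^ n * ⟪b n, v⟫_ℂ) ∧
      ∀ j, qTransform q μ Complex.I f (latticePoint q μ j) = w j := by
  have hw : Memℓp (fun n => Complex.I ^ n * ⟪b n, v⟫_ℂ) 2 := by
    refine (lp.memℓp (b.repr v)).norm.mono fun n => ?_
    rw [norm_mul, norm_pow, Complex.norm_I, one_pow, one_mul, b.repr_apply_apply]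
  let w : ℓ²(ℕ ⊕ ℕ, ℂ) := b.repr.symm ⟨_, hw⟩
  have hwcoef : ∀ n, ⟪b n, w⟫_ℂ = Complex.I ^ n * ⟪b n, v⟫_ℂ := by
    intro n
    rw [← b.repr_apply_apply, b.repr.apply_symm_apply]
  have hFw : ∀ j, qTransform q μ Complex.I f (latticePoint q μ j) = w j := by
    intro j
    rw [qTransform, (oscIntegral_kernel_mul hq0 hq1 hμ hb Complex.I j v hv).2,
      ← (hasSum_waveFun_mul_inner hb w j).tsum_eq]
    refine tsum_congr fun n => ?_
    rw [hwcoef]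
    ring
  exact ⟨w, hwcoef, hFw⟩

end HilbertBasis

end QOscillator

theorem mainTheorem4 (q μ : ℝ) (hq0 : 0 < q) (hq1 : q < 1) (hμ : 0 < μ) :
    -- the kernel series converges (absolutely) at all lattice points
    (∀ t : ℂ, ∀ x ∈ QOscillator.lattice q μ, ∀ y ∈ QOscillator.lattice q μ,
      Summable (QOscillator.kernelTerm q μ t x y)) ∧
    -- the wave functions are nonzero and square integrable
    (∀ m : ℕ,
      (∃ x ∈ QOscillator.lattice q μ, QOscillator.waveFun q μ m x ≠ 0) ∧
      QOscillator.OscSquareIntegrable q μ (fun y => (QOscillator.waveFun q μ m y : ℂ))) ∧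
    -- they are eigenfunctions of the operator with kernel `K_t`, with eigenvalue `t ^ m`
    (∀ t : ℂ, ∀ m : ℕ, ∀ x ∈ QOscillator.lattice q μ,
      QOscillator.OscIntegrable q μ
        (fun y => QOscillator.kernel q μ t x y * (QOscillator.waveFun q μ m y : ℂ)) ∧
      t ^ m * (QOscillator.waveFun q μ m x : ℂ) =
        QOscillator.qTransform q μ t (fun y => (QOscillator.waveFun q μ m y : ℂ)) x) ∧
    -- in particular, of the `q`-Fourier transform, with eigenvalue `i ^ m`
    (∀ m : ℕ, ∀ x ∈ QOscillator.lattice q μ,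
      Complex.I ^ m * (QOscillator.waveFun q μ m x : ℂ) =
        QOscillator.qTransform q μ Complex.I
          (fun y => (QOscillator.waveFun q μ m y : ℂ)) x) ∧
    -- composition of the kernels
    (∀ t t' : ℂ, ∀ x ∈ QOscillator.lattice q μ, ∀ x' ∈ QOscillator.lattice q μ,
      QOscillator.OscIntegrable q μ
        (fun y => QOscillator.kernel q μ t x y * QOscillator.kernel q μ t' x' y) ∧
      QOscillator.oscIntegral q μ
        (fun y => QOscillator.kernel q μ t x y * QOscillator.kernel q μ t' x' y) =
        QOscillator.kernel q μ (t * t') x x') ∧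
    -- orthogonality of the kernel `K_i`
    (∀ x ∈ QOscillator.lattice q μ, ∀ x' ∈ QOscillator.lattice q μ,
      QOscillator.OscIntegrable q μ
        (fun y => QOscillator.kernel q μ Complex.I x y *
          (starRingEnd ℂ) (QOscillator.kernel q μ Complex.I x' y)) ∧
      QOscillator.oscIntegral q μ
        (fun y => QOscillator.kernel q μ Complex.I x y *
          (starRingEnd ℂ) (QOscillator.kernel q μ Complex.I x' y)) =
        if x = x' then 1 else 0) ∧
    -- inversion formula for the `q`-Fourier transform on square integrable functions
    (∀ f : ℝ → ℂ, QOscillator.OscSquareIntegrable q μ f →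
      (∀ x ∈ QOscillator.lattice q μ,
        QOscillator.OscIntegrable q μ
          (fun y => QOscillator.kernel q μ Complex.I x y * f y)) ∧
      QOscillator.OscSquareIntegrable q μ (QOscillator.qTransform q μ Complex.I f) ∧
      (∀ x ∈ QOscillator.lattice q μ,
        QOscillator.OscIntegrable q μ
          (fun y => (starRingEnd ℂ) (QOscillator.kernel q μ Complex.I x y) *
            QOscillator.qTransform q μ Complex.I f y) ∧
        f x = QOscillator.oscIntegral q μ
          (fun y => (starRingEnd ℂ) (QOscillator.kernel q μ Complex.I x y) *
            QOscillator.qTransform q μ Complex.I f y))) := by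
  obtain ⟨b, hb⟩ := QOscillator.exists_hilbertBasis_waveFun hq0 hq1 hμ
  have hI : Complex.I * conj Complex.I = 1 := by simp
  refine ⟨?_, ?_, fun t m x hx => QOscillator.qTransform_waveFun hq0 hq1 hμ hb t m hx,
    fun m x hx => (QOscillator.qTransform_waveFun hq0 hq1 hμ hb Complex.I m hx).2,
    fun t t' x hx x' hx' => QOscillator.oscIntegral_kernel_mul_kernel hq0 hq1 hμ hb t t' hx hx',
    ?_, ?_⟩
  · intro t x hx y hy
    obtain ⟨i, rfl⟩ := QOscillator.mem_lattice_iff.1 hx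
    obtain ⟨j, rfl⟩ := QOscillator.mem_lattice_iff.1 hy
    obtain ⟨k, hk, -⟩ := QOscillator.exists_kernel_vector hq0 hq1 hμ hb t i
    exact (hk j).summable
  · intro m
    constructor
    · refine ⟨_, QOscillator.mem_lattice_iff.2 ⟨.inl 0, rfl⟩, ?_⟩
      rw [QOscillator.waveFun_latticePoint, QOscillator.latticePoint, pow_zero,
        QOscillator.alSalamCarlitz_one_right hq0 hμ, mul_one]
      exact mul_ne_zero
        (inv_ne_zero (Real.sqrt_pos.2 (QOscillator.normSq_pos hq0 hq1 hμ m)).ne')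
        (Real.sqrt_pos.2 (QOscillator.mass_pos hq0 hq1 hμ _)).ne'
    · rw [QOscillator.oscSquareIntegrable_iff hq0 hμ]
      simpa only [← hb] using lp.memℓp (b m)
  · intro x hx x' hx'
    simp only [QOscillator.conj_kernel]
    have h := QOscillator.oscIntegral_kernel_mul_kernel hq0 hq1 hμ hb Complex.I (conj Complex.I)
      hx hx'
    refine ⟨h.1, h.2.trans ?_⟩
    obtain ⟨i, rfl⟩ := QOscillator.mem_lattice_iff.1 hx
    obtain ⟨i', rfl⟩ := QOscillator.mem_lattice_iff.1 hx'
    rw [hI, QOscillator.kernel_one hq0 hq1 hμ hb]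
  · intro f hf
    let v : ℓ²(ℕ ⊕ ℕ, ℂ) := ⟨_, (QOscillator.oscSquareIntegrable_iff hq0 hμ).1 hf⟩
    have hv : ∀ j, f (QOscillator.latticePoint q μ j) = v j := fun j => rfl
    obtain ⟨w, hwcoef, hFw⟩ := QOscillator.exists_vector_qTransform hq0 hq1 hμ hb hv
    refine ⟨?_, ?_, ?_⟩
    · intro x hx
      obtain ⟨i, rfl⟩ := QOscillator.mem_lattice_iff.1 hx
      exact (QOscillator.oscIntegral_kernel_mul hq0 hq1 hμ hb Complex.I i v hv).1
    · rw [QOscillator.oscSquareIntegrable_iff hq0 hμ]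
      simpa only [hFw] using lp.memℓp w
    · intro x hx
      obtain ⟨i, rfl⟩ := QOscillator.mem_lattice_iff.1 hx
      simp only [QOscillator.conj_kernel]
      obtain ⟨h1, h2⟩ :=
        QOscillator.oscIntegral_kernel_mul hq0 hq1 hμ hb (conj Complex.I) i w hFw
      refine ⟨h1, ?_⟩
      rw [h2, hv, ← (QOscillator.hasSum_waveFun_mul_inner hb v i).tsum_eq]
      refine tsum_congr fun n => ?_
      have hIn : (conj Complex.I) ^ n * Complex.I ^ n = 1 := by
        rw [← mul_pow, mul_comm, hI, one_pow]
      rw [hwcoef]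
      linear_combination
        -(QOscillator.waveFun q μ n (QOscillator.latticePoint q μ i) : ℂ) * ⟪b n, v⟫_ℂ * hIn
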